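/- Let $d\ge 1$, let $\Omega\subset\mathbb R^d$ be a bounded open set, let $H_0^1(\Omega)$ be the closure of $C_c^\infty(\Omega)$ in $H^1(\Omega)$, with $\|v\|_{H_0^1}=\|\nabla v\|_{L^2}$ (all spaces real), and let $T,\nu>0$. There is a constant $C>0$, depending only on $d$, $\Omega$, $T$ and $\nu$ (so not on any of the discretization parameters $V^h$, $N$, $\Delta t$, $r$, nor on the data), with the following property. Let $V^h\subset H_0^1(\Omega)$ be a finite-dimensional subspace, $N\ge 2$, $\Delta t=T/(N-1)$, and let $f^n\in L^2(\Omega)$ be given. Let $u^1,\dots,u^N\in V^h$ be a backward Euler Galerkin solution of the heat equation, i.e. for $n=1,\dots,N-1$, $$\Big(\frac{u^{n+1}-u^n}{\Delta t},v\Big)_{L^2}+\nu(\nabla u^{n+1},\nabla v)_{L^2}=(f^{n+1},v)_{L^2}\qquad\forall v\in V^h .$$ Let $\partial u^j=(u^{j+1}-u^j)/\Delta t$ and let $K_1:\mathbb R^N\to L^2(\Omega)$, $K_1g=g^1u^1+\sum_{j=1}^{N-1}\Delta t\,g^{j+1}\,\partial u^j$, where $\mathbb R^N$ carries the inner product $(g,h)_S=g^1h^1+\sum_{j=2}^N\Delta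 t\,g^jh^j$. Let $\{(\lambda_i^{DQ1})^{1/2},f_i,\varphi_i\}_{i=1}^m$ be a singular value decomposition of $K_1$: $\lambda_1^{DQ1}\ge\lambda_2^{DQ1}\ge\dots\ge\lambda_m^{DQ1}\ge 0$, the $f_i$ orthonormal for $(\cdot,\cdot)_S$, the POD modes $\varphi_i\in H_0^1(\Omega)$ orthonormal in $L^2(\Omega)$, and $K_1g=\sum_{i=1}^m(\lambda_i^{DQ1})^{1/2}(g,f_i)_S\,\varphi_i$ for all $g$. Let $s$ be the number of positive $\lambda_i^{DQ1}$, let $0\le r\le m$ be such that $\varphi_1,\dots,\varphi_r\in V^h$ (automatic if $r\le s$), and put $V_r^h=\operatorname{span}\{\varphi_1,\dots,\varphi_r\}$. Let $R_r:H_0^1(\Omega)\to V_r^h$ be the Ritz projection, $(\nabla(w-R_rw),\nabla v_r)_{L^2}=0$ for all $v_r\in V_r^h$. Let $u_r^1,\dots,u_r^N\in V_r^h$ be a solution of the reduced order model, i.e. for $n=1,\dots,N-1$, $$\Big(\frac{u_r^{n+1}-u_r^n}{\Delta t},v_r\Big)_{L^2}+\nu(\nabla u_r^{n+1},\nabla v_r)_{L^2}=(f^{n+1},v_r)_{L^2}\qquad\forall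 v_r\in V_r^h ,$$ with any initial value $u_r^1\in V_r^h$ (for instance the $L^2$-orthogonal projection of $u^1$ onto $V_r^h$). Then $e^k=u^k-u_r^k$ and $\phi_r^1=u_r^1-R_ru^1$ satisfy $$\max_{1\le k\le N}\|\nabla e^k\|_{L^2}^2\le C\left(\sum_{i=r+1}^{s}\lambda_i^{DQ1}\Big(\|\varphi_i-R_r\varphi_i\|_{L^2}^2+\|\nabla(\varphi_i-R_r\varphi_i)\|_{L^2}^2\Big)+\|\phi_r^1\|_{H_0^1}^2\right).$$ -/

import Mathlib

open MeasureTheory TopologicalSpace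
open scoped Distributions Gradient InnerProductSpace

/-- The real Lebesgue space `L²(Ω)`. -/
noncomputable abbrev L2 {d : ℕ} (Ω : Opens (EuclideanSpace ℝ (Fin d))) :=
  Lp ℝ 2 (volume.restrict (Ω : Set (EuclideanSpace ℝ (Fin d))))

/-- The space `L²(Ω; ℝᵈ)` of square integrable vector fields. -/
noncomputable abbrev L2Vec {d : ℕ} (Ω : Opens (EuclideanSpace ℝ (Fin d))) :=
  Lp (EuclideanSpace ℝ (Fin d)) 2 (volume.restrict (Ω : Set (EuclideanSpace ℝ (Fin d))))

/-- The pairs `(φ, ∇φ)`, `φ ∈ C_c^∞(Ω)`, inside `L²(Ω) × L²(Ω; ℝᵈ)`. -/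
def testGraph {d : ℕ} (Ω : Opens (EuclideanSpace ℝ (Fin d))) :
    Submodule ℝ (L2 Ω × L2Vec Ω) where
  carrier := {p | ∃ φ : 𝓓(Ω, ℝ),
    p.1 =ᵐ[volume.restrict (Ω : Set (EuclideanSpace ℝ (Fin d)))] (fun x => φ x) ∧
    p.2 =ᵐ[volume.restrict (Ω : Set (EuclideanSpace ℝ (Fin d)))] (fun x => ∇ φ x)}
  zero_mem' := by
    refine ⟨0, ?_, ?_⟩
    · exact (Lp.coeFn_zero _ _ _).trans (by simp; rfl)
    · refine (Lp.coeFn_zero _ _ _).trans (Filter.Eventually.of_forall fun x => ?_)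
      have : ((0 : 𝓓(Ω, ℝ)) : EuclideanSpace ℝ (Fin d) → ℝ) = fun _ => 0 := rfl
      simp [this]
  add_mem' := by
    rintro p q ⟨φ, hφ, hφ'⟩ ⟨ψ, hψ, hψ'⟩
    refine ⟨φ + ψ, ?_, ?_⟩
    · filter_upwards [Lp.coeFn_add p.1 q.1, hφ, hψ] with x h h1 h2
      exact h.trans (congrArg₂ (· + ·) h1 h2)
    · filter_upwards [Lp.coeFn_add p.2 q.2, hφ', hψ'] with x h h1 h2
      have e : ((φ + ψ : 𝓓(Ω, ℝ)) : EuclideanSpace ℝ (Fin d) → ℝ) = ⇑φ + ⇑ψ := rfl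
      have d1 : DifferentiableAt ℝ φ x := (φ.contDiff.differentiable (by simp)) x
      have d2 : DifferentiableAt ℝ ψ x := (ψ.contDiff.differentiable (by simp)) x
      refine (h.trans (congrArg₂ (· + ·) h1 h2)).trans ?_
      simp [e, gradient, fderiv_add d1 d2]
  smul_mem' := by
    rintro c p ⟨φ, hφ, hφ'⟩
    refine ⟨c • φ, ?_, ?_⟩
    · filter_upwards [Lp.coeFn_smul c p.1, hφ] with x h h1
      exact h.trans (congrArg (c • ·) h1)
    · filter_upwards [Lp.coeFn_smul c p.2, hφ'] with x h h1
      have e : ((c • φ : 𝓓(Ω, ℝ)) : EuclideanSpace ℝ (Fin d) → ℝ) = c • ⇑φ := rfl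
      have d1 : DifferentiableAt ℝ φ x := (φ.contDiff.differentiable (by simp)) x
      refine (h.trans (congrArg (c • ·) h1)).trans ?_
      simp [e, gradient, fderiv_const_smul d1]

/-- The Sobolev space `H¹₀(Ω)`: the closure of `C_c^∞(Ω)` in the `H¹` norm. A function
`u ∈ H¹₀(Ω)` is carried together with its weak gradient, as the pair `(u, ∇u)`; see
`H10.integral_mul_inner` and `H10.toL2_injective`. -/
noncomputable def H10 {d : ℕ} (Ω : Opens (EuclideanSpace ℝ (Fin d))) :
    Submodule ℝ (L2 Ω × L2Vec Ω) :=
  (testGraph Ω).topologicalClosure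

namespace H10

/-- The inclusion `H¹₀(Ω) → L²(Ω)`. -/
noncomputable def toL2 {d : ℕ} {Ω : Opens (EuclideanSpace ℝ (Fin d))} : H10 Ω →ₗ[ℝ] L2 Ω :=
  (LinearMap.fst ℝ (L2 Ω) (L2Vec Ω)).comp (H10 Ω).subtype

/-- The weak gradient `∇ : H¹₀(Ω) → L²(Ω; ℝᵈ)`. The `H¹₀` norm of `u` is `‖H10.grad u‖`. -/
noncomputable def grad {d : ℕ} {Ω : Opens (EuclideanSpace ℝ (Fin d))} : H10 Ω →ₗ[ℝ] L2Vec Ω :=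
  (LinearMap.snd ℝ (L2 Ω) (L2Vec Ω)).comp (H10 Ω).subtype

/-- `grad u` is the weak gradient of `toL2 u`. -/
theorem integral_mul_inner {d : ℕ} {Ω : Opens (EuclideanSpace ℝ (Fin d))} (u : H10 Ω)
    (ψ : 𝓓(Ω, ℝ)) (v : EuclideanSpace ℝ (Fin d)) :
    ∫ x in (Ω : Set (EuclideanSpace ℝ (Fin d))), toL2 u x * ⟪∇ ψ x, v⟫_ℝ =
      - ∫ x in (Ω : Set (EuclideanSpace ℝ (Fin d))), ⟪grad u x, v⟫_ℝ * ψ x := by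
  have hψc : Continuous ψ := ψ.continuous
  have hψd : Differentiable ℝ ψ := ψ.contDiff.differentiable (by simp)
  have hdc : Continuous (fun x => fderiv ℝ ψ x v) :=
    (ψ.contDiff.continuous_fderiv (by simp)).clm_apply continuous_const
  have hds : HasCompactSupport (fun x => fderiv ℝ ψ x v) :=
    ψ.hasCompactSupport.fderiv_apply ℝ v
  have hvc : Continuous (fun x => ψ x • v) := hψc.smul continuous_const
  have hvs : HasCompactSupport (fun x => ψ x • v) := ψ.hasCompactSupport.smul_right
  have m1 : MemLp (fun x => fderiv ℝ ψ x v) 2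
      (volume.restrict (Ω : Set (EuclideanSpace ℝ (Fin d)))) :=
    (hdc.memLp_of_hasCompactSupport hds).restrict _
  have m2 : MemLp (fun x => ψ x • v) 2
      (volume.restrict (Ω : Set (EuclideanSpace ℝ (Fin d)))) :=
    (hvc.memLp_of_hasCompactSupport hvs).restrict _
  have i1 : ∀ p : L2 Ω, ⟪m1.toLp, p⟫_ℝ =
      ∫ x in (Ω : Set (EuclideanSpace ℝ (Fin d))), p x * ⟪∇ ψ x, v⟫_ℝ := by
    intro p
    rw [L2.inner_def]
    refine integral_congr_ae ?_
    filter_upwards [m1.coeFn_toLp] with x hx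
    rw [hx]
    simp [gradient]
  have i2 : ∀ p : L2Vec Ω, ⟪m2.toLp, p⟫_ℝ =
      ∫ x in (Ω : Set (EuclideanSpace ℝ (Fin d))), ⟪p x, v⟫_ℝ * ψ x := by
    intro p
    rw [L2.inner_def]
    refine integral_congr_ae ?_
    filter_upwards [m2.coeFn_toLp] with x hx
    rw [hx]
    simp only [real_inner_smul_left]
    rw [real_inner_comm, mul_comm]
  have key : ∀ p ∈ H10 Ω, ⟪m1.toLp, p.1⟫_ℝ + ⟪m2.toLp, p.2⟫_ℝ = 0 := by
    intro p hp
    have hcl : IsClosed {p : L2 Ω × L2Vec Ω | ⟪m1.toLp, p.1⟫_ℝ + ⟪m2.toLp, p.2⟫_ℝ = 0} :=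
      isClosed_eq (by fun_prop) continuous_const
    refine closure_minimal ?_ hcl hp
    rintro p ⟨φ, h1, h2⟩
    have hφd : Differentiable ℝ φ := φ.contDiff.differentiable (by simp)
    have hφc : Continuous φ := φ.continuous
    have hφdc : Continuous (fun x => fderiv ℝ φ x v) :=
      (φ.contDiff.continuous_fderiv (by simp)).clm_apply continuous_const
    have e1 : ∫ x in (Ω : Set (EuclideanSpace ℝ (Fin d))), p.1 x * ⟪∇ ψ x, v⟫_ℝ =
        ∫ x, φ x * fderiv ℝ ψ x v := by
      rw [← setIntegral_eq_integral_of_forall_compl_eq_zero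
        (s := (Ω : Set (EuclideanSpace ℝ (Fin d)))) (f := fun x => φ x * fderiv ℝ ψ x v)]
      · refine integral_congr_ae ?_
        filter_upwards [h1] with x hx
        rw [hx]
        simp [gradient]
      · intro x hx
        rw [image_eq_zero_of_notMem_tsupport fun h => hx (φ.tsupport_subset h), zero_mul]
    have e2 : ∫ x in (Ω : Set (EuclideanSpace ℝ (Fin d))), ⟪p.2 x, v⟫_ℝ * ψ x =
        ∫ x, fderiv ℝ φ x v * ψ x := by
      rw [← setIntegral_eq_integral_of_forall_compl_eq_zero
        (s := (Ω : Set (EuclideanSpace ℝ (Fin d)))) (f := fun x => fderiv ℝ φ x v * ψ x)]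
      · refine integral_congr_ae ?_
        filter_upwards [h2] with x hx
        rw [hx]
        simp [gradient]
      · intro x hx
        rw [image_eq_zero_of_notMem_tsupport fun h => hx (ψ.tsupport_subset h), mul_zero]
    change ⟪m1.toLp, p.1⟫_ℝ + ⟪m2.toLp, p.2⟫_ℝ = 0
    rw [i1, i2, e1, e2, integral_mul_fderiv_eq_neg_fderiv_mul_of_integrable _ _ _
      (fun x _ => hφd x) (fun x _ => hψd x)]
    · ring
    · exact (hφdc.mul hψc).integrable_of_hasCompactSupport ψ.hasCompactSupport.mul_left
    · exact (hφc.mul hdc).integrable_of_hasCompactSupport φ.hasCompactSupport.mul_right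
    · exact (hφc.mul hψc).integrable_of_hasCompactSupport φ.hasCompactSupport.mul_right
  have h := key u.1 u.2
  rw [i1, i2] at h
  exact eq_neg_of_add_eq_zero_left h

/-- An element of `H¹₀(Ω)` is determined by its underlying function. -/
theorem toL2_injective {d : ℕ} (Ω : Opens (EuclideanSpace ℝ (Fin d))) :
    Function.Injective (toL2 : H10 Ω →ₗ[ℝ] L2 Ω) := by
  refine (injective_iff_map_eq_zero _).2 fun u hu => ?_
  have h2 : grad u = 0 := by
    refine (Lp.eq_zero_iff_ae_eq_zero).2 ?_
    have hv : ∀ i : Fin d, ∀ᵐ x ∂(volume.restrict (Ω : Set (EuclideanSpace ℝ (Fin d)))),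
        grad u x i = 0 := by
      intro i
      rw [ae_restrict_iff' Ω.isOpen.measurableSet]
      have hm : MemLp (fun x => grad u x i) 2
          (volume.restrict (Ω : Set (EuclideanSpace ℝ (Fin d)))) :=
        (EuclideanSpace.proj (𝕜 := ℝ) i).comp_memLp' (Lp.memLp (grad u))
      refine Ω.isOpen.ae_eq_zero_of_integral_contDiff_smul_eq_zero ?_ ?_
      · have hl : LocallyIntegrable (fun x => grad u x i)
            (volume.restrict (Ω : Set (EuclideanSpace ℝ (Fin d)))) :=
          hm.locallyIntegrable (by norm_num)
        exact locallyIntegrableOn_of_locallyIntegrable_restrict hl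
      · intro g hg hgc hgs
        have h := integral_mul_inner u ⟨g, hg, hgc, hgs⟩ (EuclideanSpace.single i 1)
        have hz : ∫ x in (Ω : Set (EuclideanSpace ℝ (Fin d))), toL2 u x *
            ⟪∇ (⟨g, hg, hgc, hgs⟩ : 𝓓(Ω, ℝ)) x, EuclideanSpace.single i 1⟫_ℝ = 0 := by
          rw [hu]
          refine integral_eq_zero_of_ae ?_
          filter_upwards [Lp.coeFn_zero ℝ 2
            (volume.restrict (Ω : Set (EuclideanSpace ℝ (Fin d))))] with x hx
          rw [hx]
          simp
        rw [hz] at h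
        rw [← setIntegral_eq_integral_of_forall_compl_eq_zero
          (s := (Ω : Set (EuclideanSpace ℝ (Fin d))))]
        · have h' := neg_eq_zero.1 h.symm
          refine Eq.trans (integral_congr_ae (Filter.Eventually.of_forall fun x => ?_)) h'
          simp [EuclideanSpace.inner_single_right, mul_comm]
        · intro x hx
          rw [image_eq_zero_of_notMem_tsupport fun h => hx (hgs h), zero_smul]
    filter_upwards [ae_all_iff.2 hv] with x hx
    ext i
    simpa using hx i
  exact Subtype.ext (Prod.ext hu h2)

end H10

theorem exists_ritzProj {d : ℕ} {Ω : Opens (EuclideanSpace ℝ (Fin d))} (W : Submodule ℝ (H10 Ω))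
    [FiniteDimensional ℝ W] (w : H10 Ω) :
    ∃ z ∈ W, ∀ v ∈ W, ⟪H10.grad (w - z), H10.grad v⟫_ℝ = 0 := by
  obtain ⟨z, hz, hz'⟩ := (W.map H10.grad).starProjection_apply_mem (H10.grad w)
  refine ⟨z, hz, fun v hv => ?_⟩
  rw [map_sub, hz']
  exact (W.map H10.grad).starProjection_inner_eq_zero _ _ (Submodule.mem_map_of_mem hv)

/-- The Ritz projection `R_W w` of `w ∈ H¹₀(Ω)` onto a finite-dimensional subspace `W`: the
`z ∈ W` with `(∇(w - z), ∇v) = 0` for all `v ∈ W`. On a bounded `Ω ⊂ ℝᵈ`, `d ≥ 1`, it is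
unique. -/
noncomputable def ritzProj {d : ℕ} {Ω : Opens (EuclideanSpace ℝ (Fin d))}
    (W : Submodule ℝ (H10 Ω)) [FiniteDimensional ℝ W] (w : H10 Ω) : H10 Ω :=
  (exists_ritzProj W w).choose

/-- `u 1, …, u N` is a backward Euler Galerkin solution, in the subspace `W ⊂ H¹₀(Ω)`, of the heat
equation `∂ₜu - ν Δu = F` with time step `δ` and homogeneous Dirichlet boundary conditions. -/
def IsBackwardEuler {d : ℕ} {Ω : Opens (EuclideanSpace ℝ (Fin d))} (ν δ : ℝ) (N : ℕ)
    (F : ℕ → L2 Ω) (W : Submodule ℝ (H10 Ω)) (u : ℕ → H10 Ω) : Prop :=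
  (∀ n, 1 ≤ n → n ≤ N → u n ∈ W) ∧
  ∀ n, 1 ≤ n → n < N → ∀ v ∈ W,
    ⟪H10.toL2 (δ⁻¹ • (u (n + 1) - u n)), H10.toL2 v⟫_ℝ
      + ν * ⟪H10.grad (u (n + 1)), H10.grad v⟫_ℝ = ⟪F (n + 1), H10.toL2 v⟫_ℝ

/-- The POD operator `K g = ∑ⱼ γⱼ gʲ wʲ` of the data `w` with weights `γ`. -/
def podOperator {X : Type*} [NormedAddCommGroup X] [InnerProductSpace ℝ X] {M : ℕ}
    (γ : Fin M → ℝ) (w : Fin M → X) (g : Fin M → ℝ) : X :=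
  ∑ j, (γ j * g j) • w j

/-- The weighted inner product `(g, h)_S = ∑ⱼ γⱼ gʲ hʲ` on `S = ℝᴹ`. -/
def weightedInner {M : ℕ} (γ g h : Fin M → ℝ) : ℝ :=
  ∑ j, γ j * g j * h j

/-- `{σ_k, f_k, φ_k}` is a singular value decomposition of the POD operator `K : S → X` of the
data `w` with weights `γ`: the singular values are nonnegative and in decreasing order, the
singular vectors are orthonormal in `S` and in `X`, and `K = ∑ₖ σ_k (·, f_k)_S φ_k`. The `φ_k` are
the POD modes and the `σ_k ^ 2` the POD eigenvalues; some of the `σ_k` may be zero. -/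
structure IsPODSVD {X : Type*} [NormedAddCommGroup X] [InnerProductSpace ℝ X] {M m : ℕ}
    (γ : Fin M → ℝ) (w : Fin M → X) (σ : Fin m → ℝ) (f : Fin m → Fin M → ℝ) (φ : Fin m → X) :
    Prop where
  nonneg : ∀ k, 0 ≤ σ k
  antitone : Antitone σ
  orthonormal_left : ∀ k l, weightedInner γ (f k) (f l) = if k = l then 1 else 0
  orthonormal_right : Orthonormal ℝ φ
  apply_eq : ∀ g, podOperator γ w g = ∑ k, (σ k * weightedInner γ g (f k)) • φ k

/-- The data of the difference quotient approach: `w¹ = u¹` and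
`wⁱ⁺¹ = (uⁱ⁺¹ - uⁱ) / δ` for `1 ≤ i ≤ N - 1`; the vector `wⁱ⁺¹` has the index `i : Fin N`. -/
noncomputable def dqData {X : Type*} [AddCommGroup X] [Module ℝ X] (N : ℕ) (δ : ℝ) (u : ℕ → X)
    (i : Fin N) : X :=
  if (i : ℕ) = 0 then u 1 else δ⁻¹ • (u (i + 1) - u i)

/-- The weights of the difference quotient approach: `γ₁ = 1` and `γᵢ₊₁ = δ`. -/
def dqWeight (N : ℕ) (δ : ℝ) (i : Fin N) : ℝ :=
  if (i : ℕ) = 0 then 1 else δ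

/-- `V_r`, the span of the first `r` POD modes. -/
def podSpace {V : Type*} [AddCommGroup V] [Module ℝ V] {m : ℕ} (φ : Fin m → V) (r : ℕ) :
    Submodule ℝ V :=
  Submodule.span ℝ (φ '' {k | (k : ℕ) < r})

instance {V : Type*} [AddCommGroup V] [Module ℝ V] {m : ℕ} (φ : Fin m → V) (r : ℕ) :
    FiniteDimensional ℝ (podSpace φ r) :=
  FiniteDimensional.span_of_finite ℝ (Set.toFinite _)

/-! Write R for the Ritz projection onto V_r and E = 1 - R. The error splits as e^k = E u^k - p^k
with p^k = u_r^k - R u^k in V_r. Subtract the two schemes and test in V_r: the gradient of E u^{n+1}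
drops out by orthogonality, so p solves backward Euler with right-hand side E ∂u^n. Testing with the
difference quotient of p bounds ‖∇p^k‖² by ‖∇p^1‖² plus ν⁻¹ times the time sum of ‖E ∂u^j‖²
(`norm_sq_backwardEuler_le`).

The maximum over k of ‖∇E u^k‖² is controlled by the value at k = 1 and the time sum of ‖∇E ∂u^j‖²
(`norm_sq_le_sum_norm_sq_differenceQuotient`). This is why the POD data are u^1 and the difference
quotients: pointwise bounds in time follow with no loss in Δt.

Both sums are weighted sums of ‖L w‖² over the POD data w, with L = E in L² or L = ∇E.
`IsPODSVD.sum_weight_mul_norm_sq_eq_tail` turns each into its POD tail exactly, as E is linear and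
kills the first r modes. Linearity of E needs a unique Ritz projection, hence Poincaré's inequality.
-/

/-! ### Poincaré's inequality and injectivity of the weak gradient. -/

namespace H10

/-- Poincaré's inequality on `H¹₀(Ω)` for a bounded `Ω ⊂ ℝᵈ`, `d ≥ 1`. -/
theorem norm_toL2_le_of_subset_closedBall {d : ℕ} (hd : 1 ≤ d)
    {Ω : Opens (EuclideanSpace ℝ (Fin d))} {R : ℝ} (hR0 : 0 ≤ R)
    (hR : (Ω : Set (EuclideanSpace ℝ (Fin d))) ⊆ Metric.closedBall 0 R) (u : H10 Ω) :
    ‖toL2 u‖ ≤ 2 * R * ‖grad u‖ := by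
  have key : ∀ p ∈ H10 Ω, ‖p.1‖ ≤ 2 * R * ‖p.2‖ := by
    intro p hp
    have hcl : IsClosed {p : L2 Ω × L2Vec Ω | ‖p.1‖ ≤ 2 * R * ‖p.2‖} :=
      isClosed_le continuous_fst.norm (continuous_const.mul continuous_snd.norm)
    refine closure_minimal ?_ hcl hp
    rintro p ⟨φ, h1, h2⟩
    let i : Fin d := ⟨0, hd⟩
    let v : EuclideanSpace ℝ (Fin d) := EuclideanSpace.single i 1
    let ℓ : EuclideanSpace ℝ (Fin d) →L[ℝ] ℝ := EuclideanSpace.proj i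
    have hφd : Differentiable ℝ φ := φ.contDiff.differentiable (by simp)
    have hφc : Continuous φ := φ.continuous
    have hφdc : Continuous (fun x => fderiv ℝ φ x v) :=
      (φ.contDiff.continuous_fderiv (by simp)).clm_apply continuous_const
    have hsq : ∀ x, fderiv ℝ (fun x => φ x * φ x) x v = 2 * (φ x * fderiv ℝ φ x v) := by
      intro x
      rw [fderiv_fun_mul (hφd x) (hφd x)]
      simp
      ring
    have hℓ : ∀ x, fderiv ℝ ℓ x v = 1 := by
      intro x
      rw [ℓ.fderiv]
      simp [ℓ, v]
    -- Integration by parts against the coordinate function `ℓ`, whose derivative along `v` is 1.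
    have hibp : ∫ x, φ x * φ x = - ∫ x, (2 * (φ x * fderiv ℝ φ x v)) * ℓ x := by
      have h := integral_mul_fderiv_eq_neg_fderiv_mul_of_integrable
        (μ := (volume : Measure (EuclideanSpace ℝ (Fin d)))) (𝕜 := ℝ)
        (f := fun x => φ x * φ x) (g := ℓ) (v := v) ?_ ?_ ?_
        (fun x _ => (hφd x).mul (hφd x)) (fun x _ => ℓ.differentiableAt)
      · simpa only [hsq, hℓ, mul_one] using h
      · simp only [hsq]
        exact Continuous.integrable_of_hasCompactSupport (by fun_prop)
          ((φ.hasCompactSupport.mul_right.mul_left).mul_right)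
      · simp only [hℓ, mul_one]
        exact (hφc.mul hφc).integrable_of_hasCompactSupport φ.hasCompactSupport.mul_right
      · exact Continuous.integrable_of_hasCompactSupport (by fun_prop)
          (φ.hasCompactSupport.mul_right.mul_right)
    have e1 : ⟪p.1, p.1⟫_ℝ = ∫ x, φ x * φ x := by
      rw [L2.inner_def, ← setIntegral_eq_integral_of_forall_compl_eq_zero
        (s := (Ω : Set (EuclideanSpace ℝ (Fin d)))) (f := fun x => φ x * φ x)]
      · refine integral_congr_ae ?_
        filter_upwards [h1] with x hx
        rw [hx, real_inner_self_eq_norm_mul_norm, Real.norm_eq_abs, abs_mul_abs_self]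
      · intro x hx
        rw [image_eq_zero_of_notMem_tsupport fun h => hx (φ.tsupport_subset h), zero_mul]
    -- This field lets Cauchy–Schwarz act on the whole gradient `p.2`; its norm costs the factor
    -- `R`, since |`ℓ`| ≤ `R` on Ω.
    have hm : MemLp (fun x => (ℓ x * φ x) • v) 2
        (volume.restrict (Ω : Set (EuclideanSpace ℝ (Fin d)))) :=
      (Continuous.memLp_of_hasCompactSupport (by fun_prop)
        (φ.hasCompactSupport.mul_left.smul_right)).restrict _
    have e2 : ⟪hm.toLp, p.2⟫_ℝ = ∫ x, φ x * fderiv ℝ φ x v * ℓ x := by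
      rw [L2.inner_def, ← setIntegral_eq_integral_of_forall_compl_eq_zero
        (s := (Ω : Set (EuclideanSpace ℝ (Fin d)))) (f := fun x => φ x * fderiv ℝ φ x v * ℓ x)]
      · refine integral_congr_ae ?_
        filter_upwards [h2, hm.coeFn_toLp] with x hx hx'
        rw [hx, hx', real_inner_smul_left, real_inner_comm]
        simp [gradient]
        ring
      · intro x hx
        rw [image_eq_zero_of_notMem_tsupport fun h => hx (φ.tsupport_subset h), zero_mul, zero_mul]
    have hle : ‖hm.toLp‖ ≤ R * ‖p.1‖ := by
      refine Lp.norm_le_mul_norm_of_ae_le_mul ?_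
      filter_upwards [h1, hm.coeFn_toLp, ae_restrict_mem Ω.isOpen.measurableSet] with x hx hx' hxΩ
      have hxR : ‖x i‖ ≤ R := (PiLp.norm_apply_le x i).trans (by simpa using hR hxΩ)
      rw [hx, hx', norm_smul, norm_mul]
      simpa [v, ℓ] using mul_le_mul_of_nonneg_right hxR (norm_nonneg (φ x))
    have hfin : ‖p.1‖ * ‖p.1‖ ≤ 2 * R * ‖p.2‖ * ‖p.1‖ := by
      rw [← real_inner_self_eq_norm_mul_norm, e1, hibp]
      simp only [mul_assoc (2 : ℝ)]
      rw [integral_const_mul, ← e2]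
      nlinarith [abs_le.1 (abs_real_inner_le_norm hm.toLp p.2),
        mul_le_mul_of_nonneg_right hle (norm_nonneg p.2)]
    change ‖p.1‖ ≤ 2 * R * ‖p.2‖
    rcases (norm_nonneg p.1).eq_or_lt with h0 | h0
    · rw [← h0]
      positivity
    · exact le_of_mul_le_mul_right hfin h0
  exact key u.1 u.2

/-- Makes the gradient form definite, so that Ritz projections are unique. -/
theorem grad_injective {d : ℕ} (hd : 1 ≤ d) {Ω : Opens (EuclideanSpace ℝ (Fin d))}
    (hΩ : Bornology.IsBounded (Ω : Set (EuclideanSpace ℝ (Fin d)))) :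
    Function.Injective (grad : H10 Ω →ₗ[ℝ] L2Vec Ω) := by
  refine (injective_iff_map_eq_zero _).2 fun u hu => toL2_injective Ω ?_
  obtain ⟨R, hR0, hR⟩ := hΩ.exists_pos_norm_le
  rw [map_zero, ← norm_le_zero_iff]
  simpa [hu] using norm_toL2_le_of_subset_closedBall hd hR0.le
    (fun x hx => mem_closedBall_zero_iff.2 (hR x hx)) u

end H10

/-! ### Linearity of the Ritz projection. -/

section RitzProjection

variable {d : ℕ} {Ω : Opens (EuclideanSpace ℝ (Fin d))} (W : Submodule ℝ (H10 Ω))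
  [FiniteDimensional ℝ W]

theorem ritzProj_mem (w : H10 Ω) : ritzProj W w ∈ W :=
  (exists_ritzProj W w).choose_spec.1

theorem inner_grad_sub_ritzProj (w : H10 Ω) {v : H10 Ω} (hv : v ∈ W) :
    ⟪H10.grad (w - ritzProj W w), H10.grad v⟫_ℝ = 0 :=
  (exists_ritzProj W w).choose_spec.2 v hv

/-- Two candidates differ by an element of `W` whose gradient is orthogonal to itself. As `ritzProj`
is a mere choice, its algebraic properties all come from this uniqueness. -/
theorem ritzProj_eq_of_orthogonal
    (hinj : Function.Injective (H10.grad : H10 Ω →ₗ[ℝ] L2Vec Ω)) {w z : H10 Ω} (hz : z ∈ W)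
    (h : ∀ v ∈ W, ⟪H10.grad (w - z), H10.grad v⟫_ℝ = 0) : ritzProj W w = z := by
  have hm : ritzProj W w - z ∈ W := W.sub_mem (ritzProj_mem W w) hz
  rw [← sub_eq_zero]
  refine (injective_iff_map_eq_zero _).1 hinj _ ?_
  rw [← inner_self_eq_zero (𝕜 := ℝ)]
  have e : ritzProj W w - z = (w - z) - (w - ritzProj W w) := by abel
  nth_rewrite 1 [e]
  rw [map_sub, inner_sub_left, h _ hm, inner_grad_sub_ritzProj W w hm, sub_zero]

theorem ritzProj_add (hinj : Function.Injective (H10.grad : H10 Ω →ₗ[ℝ] L2Vec Ω))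
    (w w' : H10 Ω) : ritzProj W (w + w') = ritzProj W w + ritzProj W w' := by
  refine ritzProj_eq_of_orthogonal W hinj
    (W.add_mem (ritzProj_mem W w) (ritzProj_mem W w')) fun v hv => ?_
  have e : w + w' - (ritzProj W w + ritzProj W w') = (w - ritzProj W w) + (w' - ritzProj W w') := by
    abel
  rw [e, map_add, inner_add_left, inner_grad_sub_ritzProj W w hv,
    inner_grad_sub_ritzProj W w' hv, add_zero]

theorem ritzProj_smul (hinj : Function.Injective (H10.grad : H10 Ω →ₗ[ℝ] L2Vec Ω))
    (c : ℝ) (w : H10 Ω) : ritzProj W (c • w) = c • ritzProj W w := by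
  refine ritzProj_eq_of_orthogonal W hinj (W.smul_mem c (ritzProj_mem W w)) fun v hv => ?_
  have e : c • w - c • ritzProj W w = c • (w - ritzProj W w) := (smul_sub _ _ _).symm
  rw [e, map_smul, real_inner_smul_left, inner_grad_sub_ritzProj W w hv, mul_zero]

/-- The error `w - R_W w` of the Ritz projection, as a linear map. -/
noncomputable def ritzError (hinj : Function.Injective (H10.grad : H10 Ω →ₗ[ℝ] L2Vec Ω)) :
    H10 Ω →ₗ[ℝ] H10 Ω :=
  LinearMap.id -
    { toFun := ritzProj W
      map_add' := ritzProj_add W hinj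
      map_smul' := ritzProj_smul W hinj }

theorem ritzError_apply (hinj : Function.Injective (H10.grad : H10 Ω →ₗ[ℝ] L2Vec Ω))
    (w : H10 Ω) : ritzError W hinj w = w - ritzProj W w := rfl

theorem ritzError_eq_zero (hinj : Function.Injective (H10.grad : H10 Ω →ₗ[ℝ] L2Vec Ω))
    {w : H10 Ω} (hw : w ∈ W) : ritzError W hinj w = 0 := by
  rw [ritzError_apply, ritzProj_eq_of_orthogonal W hinj hw (by simp), sub_self]

end RitzProjection

/-! ### Estimates in discrete time. -/

section Discrete

variable {V X Y : Type*} [AddCommGroup V] [Module ℝ V] [NormedAddCommGroup X]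
  [InnerProductSpace ℝ X] [NormedAddCommGroup Y] [InnerProductSpace ℝ Y]

/-- Stability of the backward Euler scheme in the energy norm. -/
theorem norm_sq_backwardEuler_le (A : V →ₗ[ℝ] X) (G : V →ₗ[ℝ] Y) {ν δ : ℝ} (hν : 0 < ν)
    (hδ : 0 < δ) {N : ℕ} {W : Submodule ℝ V} {p : ℕ → V} {q : ℕ → X}
    (hp : ∀ n, 1 ≤ n → n ≤ N → p n ∈ W)
    (h : ∀ n, 1 ≤ n → n < N → ∀ v ∈ W,
      ⟪A (δ⁻¹ • (p (n + 1) - p n)), A v⟫_ℝ + ν * ⟪G (p (n + 1)), G v⟫_ℝ = ⟪q n, A v⟫_ℝ) :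
    ∀ n, 1 ≤ n → n ≤ N →
      ‖G (p n)‖ ^ 2 ≤ ‖G (p 1)‖ ^ 2 + ν⁻¹ * ∑ j ∈ Finset.Ico 1 n, δ * ‖q j‖ ^ 2 := by
  intro n hn
  induction n, hn using Nat.le_induction with
  | base => simp
  | succ n hn ih =>
    intro hnN
    rw [Finset.sum_Ico_succ_top hn]
    have hmem : p (n + 1) - p n ∈ W :=
      W.sub_mem (hp _ (by omega) hnN) (hp _ hn (by omega))
    -- The test function is the difference quotient of `p`; its squared L² norm on the left absorbs
    -- the half that Young's inequality produces in `hy`.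
    have h1 := h n hn (by omega) _ (W.smul_mem δ⁻¹ hmem)
    have hy : ⟪q n, A (δ⁻¹ • (p (n + 1) - p n))⟫_ℝ ≤
        (‖q n‖ ^ 2 + ‖A (δ⁻¹ • (p (n + 1) - p n))‖ ^ 2) / 2 := by
      nlinarith [real_inner_le_norm (q n) (A (δ⁻¹ • (p (n + 1) - p n))),
        sq_nonneg (‖q n‖ - ‖A (δ⁻¹ • (p (n + 1) - p n))‖)]
    have hG : (‖G (p (n + 1))‖ ^ 2 - ‖G (p n)‖ ^ 2) / 2 ≤
        ⟪G (p (n + 1)), G (p (n + 1) - p n)⟫_ℝ := by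
      rw [map_sub, inner_sub_right, real_inner_self_eq_norm_sq]
      nlinarith [real_inner_le_norm (G (p (n + 1))) (G (p n)),
        sq_nonneg (‖G (p (n + 1))‖ - ‖G (p n)‖)]
    rw [real_inner_self_eq_norm_sq, map_smul G, real_inner_smul_right] at h1
    have h2 : ν * δ⁻¹ * ((‖G (p (n + 1))‖ ^ 2 - ‖G (p n)‖ ^ 2) / 2) ≤ ‖q n‖ ^ 2 / 2 := by
      have := mul_le_mul_of_nonneg_left hG (by positivity : 0 ≤ ν * δ⁻¹)
      nlinarith [sq_nonneg ‖A (δ⁻¹ • (p (n + 1) - p n))‖]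
    have h3 : ‖G (p (n + 1))‖ ^ 2 - ‖G (p n)‖ ^ 2 ≤ ν⁻¹ * (δ * ‖q n‖ ^ 2) := by
      have := mul_le_mul_of_nonneg_left h2 (by positivity : 0 ≤ 2 * ν⁻¹ * δ)
      have e : 2 * ν⁻¹ * δ * (ν * δ⁻¹ * ((‖G (p (n + 1))‖ ^ 2 - ‖G (p n)‖ ^ 2) / 2)) =
        ‖G (p (n + 1))‖ ^ 2 - ‖G (p n)‖ ^ 2 := by field_simp
      rw [e] at this
      linarith
    rw [mul_add]
    linarith [ih (by omega)]

/-- A discrete Sobolev inequality in time. -/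
theorem norm_sq_le_sum_norm_sq_differenceQuotient {δ : ℝ} (hδ : 0 < δ) {N : ℕ} (y : ℕ → Y) {n : ℕ}
    (hn : 1 ≤ n) (hnN : n ≤ N) :
    ‖y n‖ ^ 2 ≤ 2 * ‖y 1‖ ^ 2 + 2 * (((N : ℝ) - 1) * δ) *
      ∑ j ∈ Finset.Ico 1 N, δ * ‖δ⁻¹ • (y (j + 1) - y j)‖ ^ 2 := by
  set D : ℕ → Y := fun j => δ⁻¹ • (y (j + 1) - y j) with hD
  have e : y n - y 1 = ∑ j ∈ Finset.Ico 1 n, δ • D j := by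
    rw [← Finset.sum_Ico_sub y hn]
    refine Finset.sum_congr rfl fun j _ => ?_
    simp [hD, smul_smul, hδ.ne']
  have h1 : ‖y n - y 1‖ ≤ ∑ j ∈ Finset.Ico 1 N, δ * ‖D j‖ := by
    rw [e]
    refine (norm_sum_le _ _).trans ?_
    simp only [norm_smul, Real.norm_of_nonneg hδ.le]
    exact Finset.sum_le_sum_of_subset_of_nonneg (Finset.Ico_subset_Ico_right hnN)
      fun j _ _ => by positivity
  -- Cauchy–Schwarz over the N - 1 steps; the length (N - 1)δ is later T.
  have h2 : ‖y n - y 1‖ ^ 2 ≤ ((N : ℝ) - 1) * δ * ∑ j ∈ Finset.Ico 1 N, δ * ‖D j‖ ^ 2 := by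
    refine (pow_le_pow_left₀ (norm_nonneg _) h1 2).trans (sq_sum_le_card_mul_sum_sq.trans ?_)
    rw [Nat.card_Ico, Nat.cast_sub (hn.trans hnN), Nat.cast_one, mul_assoc, Finset.mul_sum _ _ δ]
    refine le_of_eq (congrArg _ (Finset.sum_congr rfl fun j _ => ?_))
    ring
  have h3 : ‖y n‖ ≤ ‖y n - y 1‖ + ‖y 1‖ := norm_le_norm_sub_add _ _
  nlinarith [sq_nonneg (‖y n - y 1‖ - ‖y 1‖), norm_nonneg (y n)]

/-- Index 0 carries u^1 with weight 1, and every other index a difference quotient with weight δ: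
these are the quantities that the time estimates produce. -/
theorem sum_dqWeight_mul_norm_sq_dqData {N : ℕ} (hN : 1 ≤ N) (δ : ℝ) (u : ℕ → V)
    (L : V →ₗ[ℝ] Y) :
    ∑ i : Fin N, dqWeight N δ i * ‖L (dqData N δ u i)‖ ^ 2 =
      ‖L (u 1)‖ ^ 2 + ∑ j ∈ Finset.Ico 1 N, δ * ‖L (δ⁻¹ • (u (j + 1) - u j))‖ ^ 2 := by
  have h := Fin.sum_univ_eq_sum_range (fun i => (if i = 0 then 1 else δ) *
    ‖L (if i = 0 then u 1 else δ⁻¹ • (u (i + 1) - u i))‖ ^ 2) N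
  refine Eq.trans ?_ (h.trans ?_)
  · rfl
  · rw [Finset.range_eq_Ico, Finset.sum_eq_sum_Ico_succ_bot hN]
    simp only [if_true, one_mul, zero_add]
    refine congrArg _ (Finset.sum_congr rfl fun j hj => ?_)
    have hj0 : j ≠ 0 := by
      have := (Finset.mem_Ico.1 hj).1
      omega
    simp [hj0]

/-! ### The POD error formula. -/

namespace IsPODSVD

variable {M m : ℕ} {γ : Fin M → ℝ} {σ : Fin m → ℝ} {f : Fin m → Fin M → ℝ} {φ : Fin m → V}
  {w : Fin M → V} {A : V →ₗ[ℝ] X}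

/-- Apply the decomposition to a unit vector and cancel its weight. Injectivity of `A` lifts the
identity from `X` to `V`, where maps such as the gradient, not defined on all of L², can act. -/
theorem data_eq_sum (hA : Function.Injective A) (hγ : ∀ j, γ j ≠ 0)
    (h : IsPODSVD γ (fun j => A (w j)) σ f (fun k => A (φ k))) (j : Fin M) :
    w j = ∑ k, (σ k * f k j) • φ k := by
  have h1 := h.apply_eq (Pi.single j 1)
  have e1 : podOperator γ (fun j => A (w j)) (Pi.single j 1) = γ j • A (w j) := by
    rw [podOperator, Finset.sum_eq_single j]
    · simp
    · intro b _ hb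
      simp [hb]
    · simp
  have e2 : ∀ k, weightedInner γ (Pi.single j 1) (f k) = γ j * f k j := by
    intro k
    rw [weightedInner, Finset.sum_eq_single j]
    · simp
    · intro b _ hb
      simp [hb]
    · simp
  refine hA (smul_right_injective X (hγ j) ?_)
  simp only [e1, e2] at h1
  simp only [h1, map_sum, map_smul, Finset.smul_sum, smul_smul]
  refine Finset.sum_congr rfl fun k _ => ?_
  congr 1
  ring

/-- The POD error formula: a linear map sees the data as it sees the scaled POD modes. -/
theorem sum_weight_mul_norm_sq (hA : Function.Injective A) (hγ : ∀ j, γ j ≠ 0)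
    (h : IsPODSVD γ (fun j => A (w j)) σ f (fun k => A (φ k))) (L : V →ₗ[ℝ] Y) :
    ∑ j, γ j * ‖L (w j)‖ ^ 2 = ∑ k, σ k ^ 2 * ‖L (φ k)‖ ^ 2 := by
  have e : ∀ j, γ j * ‖L (w j)‖ ^ 2 = ∑ k, ∑ l,
      (γ j * f k j * f l j) * (σ k * σ l * ⟪L (φ k), L (φ l)⟫_ℝ) := by
    intro j
    rw [h.data_eq_sum hA hγ j, ← real_inner_self_eq_norm_sq, map_sum, sum_inner,
      Finset.mul_sum]
    refine Finset.sum_congr rfl fun k _ => ?_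
    rw [inner_sum, Finset.mul_sum]
    refine Finset.sum_congr rfl fun l _ => ?_
    rw [map_smul, map_smul, real_inner_smul_left, real_inner_smul_right]
    ring
  simp only [e]
  rw [Finset.sum_comm]
  refine Finset.sum_congr rfl fun k _ => ?_
  rw [Finset.sum_comm]
  simp only [← Finset.sum_mul]
  -- Weighted orthonormality of the `f k` reduces the double sum to its diagonal.
  have ho : ∀ l, ∑ j, γ j * f k j * f l j = if k = l then 1 else 0 := h.orthonormal_left k
  simp only [ho, ite_mul, one_mul, zero_mul, Finset.sum_ite_eq, Finset.mem_univ, if_true]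
  rw [real_inner_self_eq_norm_sq, sq (σ k)]

/-- Singular values decrease and indices start at 0, so a positive `σ k` would force at least `k +
1` positive ones. -/
theorem eq_zero_of_card_le {w : Fin M → X} {φ : Fin m → X} (h : IsPODSVD γ w σ f φ) {k : Fin m}
    (hk : (Finset.univ.filter fun k => 0 < σ k).card ≤ k) : σ k = 0 := by
  by_contra hne
  have hpos : 0 < σ k := lt_of_le_of_ne (h.nonneg k) (Ne.symm hne)
  have hsub : Finset.Iic k ⊆ Finset.univ.filter fun k => 0 < σ k := fun l hl =>
    Finset.mem_filter.2 ⟨Finset.mem_univ _, hpos.trans_le (h.antitone (Finset.mem_Iic.1 hl))⟩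
  have := Finset.card_le_card hsub
  rw [Fin.card_Iic] at this
  omega

/-- The POD error formula for a linear map that vanishes on the first `r` POD modes. -/
theorem sum_weight_mul_norm_sq_eq_tail (hA : Function.Injective A) (hγ : ∀ j, γ j ≠ 0)
    (h : IsPODSVD γ (fun j => A (w j)) σ f (fun k => A (φ k))) (L : V →ₗ[ℝ] Y) {r s : ℕ}
    (hs : s = (Finset.univ.filter fun k => 0 < σ k).card)
    (hL : ∀ k : Fin m, (k : ℕ) < r → L (φ k) = 0) :
    ∑ j, γ j * ‖L (w j)‖ ^ 2 =
      ∑ k ∈ Finset.univ.filter (fun k : Fin m => r ≤ (k : ℕ) ∧ (k : ℕ) < s),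
        σ k ^ 2 * ‖L (φ k)‖ ^ 2 := by
  rw [h.sum_weight_mul_norm_sq hA hγ L]
  symm
  refine Finset.sum_subset (Finset.filter_subset _ _) fun k _ hk => ?_
  rw [Finset.mem_filter, not_and, not_and_or, not_le, not_lt] at hk
  rcases hk (Finset.mem_univ _) with hk | hk
  · simp [hL k hk]
  · simp [h.eq_zero_of_card_le (hs ▸ hk)]

end IsPODSVD

/-! ### Error estimate for the reduced order model. -/

/-- The error of the POD reduced order model in the energy norm, for a linear map `E = 1 - R`
whose complement `R` is a Ritz projection onto `W`. -/
theorem norm_sq_podError_le {A : V →ₗ[ℝ] X} {G : V →ₗ[ℝ] Y} (hA : Function.Injective A)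
    {ν δ T : ℝ} (hT : 0 < T) (hν : 0 < ν) {N : ℕ} (hN : 2 ≤ N) (hδ : δ = T / ((N : ℝ) - 1))
    {W : Submodule ℝ V} {E : V →ₗ[ℝ] V} (hEmem : ∀ w, w - E w ∈ W)
    (hEorth : ∀ w, ∀ v ∈ W, ⟪G (E w), G v⟫_ℝ = 0) {F : ℕ → X} {u ur : ℕ → V}
    (hu : ∀ n, 1 ≤ n → n < N → ∀ v ∈ W,
      ⟪A (δ⁻¹ • (u (n + 1) - u n)), A v⟫_ℝ + ν * ⟪G (u (n + 1)), G v⟫_ℝ = ⟪F (n + 1), A v⟫_ℝ)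
    (hurmem : ∀ n, 1 ≤ n → n ≤ N → ur n ∈ W)
    (hur : ∀ n, 1 ≤ n → n < N → ∀ v ∈ W,
      ⟪A (δ⁻¹ • (ur (n + 1) - ur n)), A v⟫_ℝ + ν * ⟪G (ur (n + 1)), G v⟫_ℝ = ⟪F (n + 1), A v⟫_ℝ)
    {m : ℕ} {σ : Fin m → ℝ} {f : Fin m → Fin N → ℝ} {φ : Fin m → V}
    (hpod : IsPODSVD (dqWeight N δ) (fun i => A (dqData N δ u i)) σ f (fun k => A (φ k)))
    {r s : ℕ} (hEzero : ∀ k : Fin m, (k : ℕ) < r → E (φ k) = 0)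
    (hs : s = (Finset.univ.filter fun k => 0 < σ k).card) {k : ℕ} (hk : 1 ≤ k) (hkN : k ≤ N) :
    ‖G (u k - ur k)‖ ^ 2 ≤ (4 + 4 * T + 2 * ν⁻¹) *
      (∑ i ∈ Finset.univ.filter (fun i : Fin m => r ≤ (i : ℕ) ∧ (i : ℕ) < s),
        σ i ^ 2 * (‖A (E (φ i))‖ ^ 2 + ‖G (E (φ i))‖ ^ 2) +
      ‖G (ur 1 - (u 1 - E (u 1)))‖ ^ 2) := by
  have hN1 : (0 : ℝ) < (N : ℝ) - 1 := by
    have : (2 : ℝ) ≤ N := by exact_mod_cast hN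
    linarith
  have hδ0 : 0 < δ := hδ ▸ div_pos hT hN1
  have hNδ : ((N : ℝ) - 1) * δ = T := by
    rw [hδ]
    field_simp
  have hγ : ∀ j, dqWeight N δ j ≠ 0 := by
    intro j
    rw [dqWeight]
    split_ifs
    · exact one_ne_zero
    · exact hδ0.ne'
  -- the projection error of the data, in `L²` and in `H¹₀`
  have tA := hpod.sum_weight_mul_norm_sq_eq_tail (hA) hγ (A ∘ₗ E) (r := r) hs
    fun k hk => by simp [hEzero k hk]
  have tG := hpod.sum_weight_mul_norm_sq_eq_tail (hA) hγ (G ∘ₗ E) (r := r) hs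
    fun k hk => by simp [hEzero k hk]
  rw [sum_dqWeight_mul_norm_sq_dqData (by omega)] at tA tG
  simp only [LinearMap.comp_apply] at tA tG
  -- the discrete part of the error
  have hp := norm_sq_backwardEuler_le A G hν hδ0 (N := N) (W := W)
    (p := fun n => ur n - (u n - E (u n)))
    (q := fun n => A (E (δ⁻¹ • (u (n + 1) - u n))))
    (fun n h1 h2 => W.sub_mem (hurmem n h1 h2) (hEmem _)) (by
      intro n h1 h2 v hv
      have a := hu n h1 h2 v hv
      have b := hur n h1 h2 v hv
      have c := hEorth (u (n + 1)) v hv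
      simp only [map_smul, map_sub, inner_sub_left, real_inner_smul_left] at a b c ⊢
      -- Reduced scheme minus Galerkin scheme; `c` removes the gradient of the projection error.
      linear_combination b - a + ν * c) k hk hkN
  -- the projection part of the error
  have hq := norm_sq_le_sum_norm_sq_differenceQuotient hδ0 (fun n => G (E (u n))) hk hkN
  rw [hNδ] at hq
  simp only [← map_sub, ← map_smul] at hq
  have hsplit : G (u k - ur k) =
      G (E (u k)) - G (ur k - (u k - E (u k))) := by
    rw [← map_sub]
    congr 1
    abel
  have htri : ‖G (u k - ur k)‖ ^ 2 ≤ 2 * ‖G (E (u k))‖ ^ 2 +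
      2 * ‖G (ur k - (u k - E (u k)))‖ ^ 2 := by
    rw [hsplit]
    have h := norm_sub_le (G (E (u k))) (G (ur k - (u k - E (u k))))
    nlinarith [norm_nonneg (G (E (u k)) - G (ur k - (u k - E (u k)))),
      sq_nonneg (‖G (E (u k))‖ - ‖G (ur k - (u k - E (u k)))‖)]
  simp only [mul_add, Finset.sum_add_distrib]
  rw [← tA, ← tG]
  have hmono : ∑ j ∈ Finset.Ico 1 k, δ * ‖A (E (δ⁻¹ • (u (j + 1) - u j)))‖ ^ 2 ≤
      ∑ j ∈ Finset.Ico 1 N, δ * ‖A (E (δ⁻¹ • (u (j + 1) - u j)))‖ ^ 2 :=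
    Finset.sum_le_sum_of_subset_of_nonneg (Finset.Ico_subset_Ico_right hkN)
      fun j _ _ => by positivity
  have hSA : 0 ≤ ∑ j ∈ Finset.Ico 1 N, δ * ‖A (E (δ⁻¹ • (u (j + 1) - u j)))‖ ^ 2 :=
    Finset.sum_nonneg fun j _ => by positivity
  have hSG : 0 ≤ ∑ j ∈ Finset.Ico 1 N, δ * ‖G (E (δ⁻¹ • (u (j + 1) - u j)))‖ ^ 2 :=
    Finset.sum_nonneg fun j _ => by positivity
  have hν' := mul_le_mul_of_nonneg_left hmono (inv_pos.2 hν).le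
  generalize ∑ j ∈ Finset.Ico 1 N, δ * ‖A (E (δ⁻¹ • (u (j + 1) - u j)))‖ ^ 2 = SA at *
  generalize ∑ j ∈ Finset.Ico 1 N, δ * ‖G (E (δ⁻¹ • (u (j + 1) - u j)))‖ ^ 2 = SG at *
  have hi : 0 < ν⁻¹ := inv_pos.2 hν
  generalize ν⁻¹ = μ at *
  have b1 := sq_nonneg ‖A (E (u 1))‖
  have b2 := sq_nonneg ‖G (E (u 1))‖
  have b3 := sq_nonneg ‖G (ur 1 - (u 1 - E (u 1)))‖
  -- The constant collects 2(2‖∇E u^1‖² + 2T·SG) + 2(‖∇p^1‖² + μ·SA). The surplus terms on the right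
  -- are products with T or μ, whose signs must be supplied.
  have hx : ∀ x : ℝ, 0 ≤ x → 0 ≤ T * x ∧ 0 ≤ μ * x := fun x hx => ⟨by positivity, by positivity⟩
  linarith [hx _ hSA, hx _ hSG, hx _ b1, hx _ b2, hx _ b3]

end Discrete

set_option maxHeartbeats 1000000 in
theorem mainTheorem6 (d : ℕ) (hd : 1 ≤ d) (Ω : Opens (EuclideanSpace ℝ (Fin d)))
    (hΩ : Bornology.IsBounded (Ω : Set (EuclideanSpace ℝ (Fin d))))
    (T ν : ℝ) (hT : 0 < T) (hν : 0 < ν) :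
    ∃ C : ℝ, 0 < C ∧
      ∀ (Vh : Submodule ℝ (H10 Ω)) (_ : FiniteDimensional ℝ Vh)
        (N : ℕ) (_ : 2 ≤ N) (Δt : ℝ) (_ : Δt = T / ((N : ℝ) - 1))
        (F : ℕ → L2 Ω)
        -- the finite element solution
        (u : ℕ → H10 Ω) (_ : IsBackwardEuler ν Δt N F Vh u)
        -- the `L²` POD modes of the snapshot `u¹` and all difference quotients
        (m : ℕ) (σ : Fin m → ℝ) (f : Fin m → Fin N → ℝ) (φ : Fin m → H10 Ω)
        (_ : IsPODSVD (dqWeight N Δt) (fun i => H10.toL2 (dqData N Δt u i)) σ f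
          (fun k => H10.toL2 (φ k)))
        (r : ℕ) (_ : r ≤ m) (_ : ∀ k : Fin m, (k : ℕ) < r → φ k ∈ Vh)
        -- the solution of the reduced order model
        (ur : ℕ → H10 Ω) (_ : IsBackwardEuler ν Δt N F (podSpace φ r) ur)
        -- the number of positive POD eigenvalues
        (s : ℕ) (_ : s = (Finset.univ.filter fun k => 0 < σ k).card),
        ∀ k, 1 ≤ k → k ≤ N →
          ‖H10.grad (u k - ur k)‖ ^ 2 ≤
            C * (∑ i ∈ Finset.univ.filter (fun i : Fin m => r ≤ (i : ℕ) ∧ (i : ℕ) < s),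
                σ i ^ 2 * (‖H10.toL2 (φ i - ritzProj (podSpace φ r) (φ i))‖ ^ 2
                  + ‖H10.grad (φ i - ritzProj (podSpace φ r) (φ i))‖ ^ 2)
              + ‖H10.grad (ur 1 - ritzProj (podSpace φ r) (u 1))‖ ^ 2) := by
  have hinj := H10.grad_injective hd hΩ
  refine ⟨4 + 4 * T + 2 * ν⁻¹, by positivity, ?_⟩
  intro Vh _ N hN δ hδ F u hu m σ f φ hpod r _ hφ ur hur s hs k hk hkN
  -- Allows the finite element equation to be tested with reduced functions.
  have hWV : podSpace φ r ≤ Vh :=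
    Submodule.span_le.2 (by rintro _ ⟨k, hk, rfl⟩; exact hφ k hk)
  have hE : ∀ w, w - ritzError (podSpace φ r) hinj w = ritzProj (podSpace φ r) w := fun w => by
    rw [ritzError_apply, sub_sub_cancel]
  have h := norm_sq_podError_le (A := H10.toL2) (G := H10.grad) (H10.toL2_injective Ω) hT hν hN hδ
    (W := podSpace φ r) (E := ritzError (podSpace φ r) hinj)
    (fun w => (hE w).symm ▸ ritzProj_mem _ w)
    (fun w v hv => inner_grad_sub_ritzProj _ w hv)
    (fun n h1 h2 v hv => hu.2 n h1 h2 v (hWV hv)) hur.1 hur.2 hpod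
    (fun k hk => ritzError_eq_zero _ hinj (Submodule.subset_span ⟨k, hk, rfl⟩)) hs hk hkN
  rw [hE] at h
  exact h
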